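/- For $n\ge 0$ let $B_n$ be the Coxeter graph with vertices $x_1,\dots,x_n$ in a row, with an edge labelled $4$ joining $x_1$ and $x_2$ (i.e. $m_{x_1x_2}=4$), an unlabelled edge ($m_{x_ix_{i+1}}=3$) joining $x_i$ and $x_{i+1}$ for $2\le i\le n-1$, and no other edges ($m=2$ for all other pairs); thus $B_1$ is a single vertex and $B_0$ is empty. For a Coxeter graph $\Gamma$ with vertex set $S$, let $\mathcal M(\Gamma)$ be its Artin monoid, presented as a monoid by the generators $s\in S$ and the relations $sts\cdots=tst\cdots$ ($m_{st}$ letters on each side) for all $s,t\in S$ with $m_{st}\ne\infty$. Write $\alpha\mid_L\beta$ if $\beta=\alpha\rho$ for some $\rho\in\mathcal M(\Gamma)$. A Garside element $\Delta(\Gamma)$ of $\mathcal M(\Gamma)$ is an element such that $s\mid_L\Delta(\Gamma)$ for all $s\in S$, and $\Delta(\Gamma)\mid_L\omega$ whenever $s\mid_L\omega$ for all $s\in S$. A relative Garside element $\Delta(B_n,B_{n-1})$, for the inclusion $B_{n-1}\subset B_n$ sending $x_i$ to $x_i$, is an element $R\in\mathcal M(B_n)$ with $\Delta(B_n)=\Delta(B_{n-1})\,R$,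 where $\Delta(B_{n-1})$ is mapped to $\mathcal M(B_n)$ by the homomorphism induced by the inclusion. Let $n\ge 1$. Then: (1) $\mathcal M(B_n)$ has exactly one Garside element, namely $$\Delta(B_n)=x_1(x_2x_1x_2)(x_3x_2x_1x_2x_3)\cdots(x_nx_{n-1}\cdots x_2x_1x_2\cdots x_{n-1}x_n);$$ (2) there is exactly one relative Garside element for $B_{n-1}\subset B_n$, namely $$\Delta(B_n,B_{n-1})=x_nx_{n-1}\cdots x_2x_1x_2\cdots x_{n-1}x_n;$$ (3) this element commutes with each of $x_1,\dots,x_{n-1}$ in $\mathcal M(B_n)$. -/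

import Mathlib

namespace CoxeterMatrix

universe u v

/-- The defining relations of the Artin monoid of a Coxeter matrix `M`: for all `s t` with
`m_{st} ≠ ∞` (encoded in Mathlib as `M s t ≠ 0`), the two alternating words in `s` and `t` with
`m_{st}` letters are identified. -/
inductive ArtinRel {S : Type u} (M : CoxeterMatrix S) : FreeMonoid S → FreeMonoid S → Prop
  | braid (s t : S) (hst : M s t ≠ 0) :
      ArtinRel M (FreeMonoid.ofList (CoxeterSystem.braidWord M s t))
        (FreeMonoid.ofList (CoxeterSystem.braidWord M t s))

/-- The Artin monoid `𝓜(Γ)` of the Coxeter graph `Γ` with Coxeter matrix `M`. -/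
abbrev ArtinMonoid {S : Type u} (M : CoxeterMatrix S) : Type u := PresentedMonoid M.ArtinRel

/-- The generator of the Artin monoid attached to a vertex. -/
def artinGen {S : Type u} (M : CoxeterMatrix S) (s : S) : M.ArtinMonoid :=
  PresentedMonoid.of M.ArtinRel s

/-- The element of the Artin monoid represented by a word in the generators. -/
def artinWord {S : Type u} (M : CoxeterMatrix S) (w : List S) : M.ArtinMonoid :=
  (w.map M.artinGen).prod

/-- `Δ` is a Garside element of the Artin monoid: every generator divides it on the left, and it
divides on the left every element that is divisible on the left by every generator.
(In a monoid, `a ∣ b` means `∃ c, b = a * c`.) -/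
def IsGarside {S : Type u} (M : CoxeterMatrix S) (Δ : M.ArtinMonoid) : Prop :=
  (∀ s : S, M.artinGen s ∣ Δ) ∧ ∀ ω : M.ArtinMonoid, (∀ s : S, M.artinGen s ∣ ω) → Δ ∣ ω

theorem artinWord_eq_mk {S : Type u} (M : CoxeterMatrix S) (w : List S) :
    M.artinWord w = PresentedMonoid.mk M.ArtinRel (FreeMonoid.ofList w) := by
  induction w with
  | nil => simp [artinWord]
  | cons a l ih =>
    rw [FreeMonoid.ofList_cons, map_mul, ← ih]
    simp [artinWord, artinGen, PresentedMonoid.of]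

theorem artinWord_braidWord {S : Type u} (M : CoxeterMatrix S) (s t : S) (hst : M s t ≠ 0) :
    M.artinWord (CoxeterSystem.braidWord M s t) = M.artinWord (CoxeterSystem.braidWord M t s) := by
  rw [artinWord_eq_mk, artinWord_eq_mk]
  exact PresentedMonoid.mk_eq_mk_of_rel (ArtinRel.braid s t hst)

theorem map_alternatingWord {S : Type u} {T : Type v} (f : S → T) (s t : S) (m : ℕ) :
    (CoxeterSystem.alternatingWord s t m).map f =
      CoxeterSystem.alternatingWord (f s) (f t) m := by
  induction m generalizing s t with
  | zero => rfl
  | succ m ih =>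
    rw [CoxeterSystem.alternatingWord_succ, CoxeterSystem.alternatingWord_succ, ← ih]
    simp

theorem map_braidWord {S : Type u} {T : Type v} (M : CoxeterMatrix S) (N : CoxeterMatrix T)
    (f : S → T) (hf : ∀ s t, N (f s) (f t) = M s t) (s t : S) :
    (CoxeterSystem.braidWord M s t).map f = CoxeterSystem.braidWord N (f s) (f t) := by
  rw [CoxeterSystem.braidWord, CoxeterSystem.braidWord, map_alternatingWord, hf]

/-- The homomorphism of Artin monoids `s ↦ f s` induced by an inclusion `f` of Coxeter graphs, that
is, a map of vertices preserving all the labels `m_{st}` (such a map is injective, since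
`m_{st} = 1` only for `s = t`). -/
def artinMap {S : Type u} {T : Type v} (M : CoxeterMatrix S) (N : CoxeterMatrix T) (f : S → T)
    (hf : ∀ s t, N (f s) (f t) = M s t) : M.ArtinMonoid →* N.ArtinMonoid :=
  PresentedMonoid.lift (fun s ↦ N.artinGen (f s)) (by
    rintro _ _ ⟨s, t, hst⟩
    have key := N.artinWord_braidWord (f s) (f t) (by rwa [hf])
    rw [← map_braidWord M N f hf, ← map_braidWord M N f hf] at key
    simpa [artinWord, FreeMonoid.lift_apply, Function.comp_def] using key)

/-- `R` is a relative Garside element `Δ(Γ, Γ')` for an inclusion `f` of the Coxeter graph `Γ'`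
(with Coxeter matrix `M`) into the Coxeter graph `Γ` (with Coxeter matrix `N`):
`Δ(Γ) = Δ(Γ') * R` in the Artin monoid of `Γ`. -/
def IsRelativeGarside {S : Type u} {T : Type v} (M : CoxeterMatrix S) (N : CoxeterMatrix T)
    (f : S → T) (hf : ∀ s t, N (f s) (f t) = M s t) (R : N.ArtinMonoid) : Prop :=
  ∃ (Δ' : M.ArtinMonoid) (Δ : N.ArtinMonoid),
    M.IsGarside Δ' ∧ N.IsGarside Δ ∧ Δ = artinMap M N f hf Δ' * R

/-- The Coxeter matrix of type `B_n` with its vertices numbered so that the edge labelled `4` joins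
the first two vertices (Mathlib's numbering reversed). The vertex `x_{i+1}` is `i : Fin n`. -/
def typeB (n : ℕ) : CoxeterMatrix (Fin n) := (CoxeterMatrix.B n).reindex Fin.revPerm

theorem typeB_apply {n : ℕ} (i j : Fin n) :
    typeB n i j = if i = j then 1
      else if (i : ℕ) + 1 = j ∨ (j : ℕ) + 1 = i then
        (if (i : ℕ) = 0 ∨ (j : ℕ) = 0 then 4 else 3)
      else 2 := by
  simp only [typeB, reindex_apply, CoxeterMatrix.B, Matrix.of_apply, Fin.revPerm_symm,
    Fin.revPerm_apply, Fin.rev_inj, Fin.val_rev]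
  have h1 := i.2
  have h2 := j.2
  simp only [Fin.ext_iff]
  split_ifs <;> omega

/-- `B_n ⊂ B_{n+1}`, the new vertex being the last one. -/
theorem typeB_castSucc (n : ℕ) (i j : Fin n) :
    typeB (n + 1) i.castSucc j.castSucc = typeB n i j := by
  simp [typeB_apply]

/-- The word `x_k x_{k-1} … x_2 x_1 x_2 … x_{k-1} x_k`, where `x_k` is the given vertex. -/
def palindromeWord {n : ℕ} (k : Fin n) : List (Fin n) :=
  ((List.finRange n).filter (· ≤ k)).reverse ++ ((List.finRange n).filter (· ≤ k)).tail

/-- The word `x_1 (x_2 x_1 x_2) (x_3 x_2 x_1 x_2 x_3) … (x_n … x_2 x_1 x_2 … x_n)`. -/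
def garsideWordB (n : ℕ) : List (Fin n) := (List.finRange n).flatMap palindromeWord

end CoxeterMatrix

/-! The core is Garside's argument that in this monoid generators cancel on the left and the
alternating word in `s`, `t` is their least common right multiple. Equal words are joined by a chain
of braid moves, and `HeadRel` records how their first letters split off a local lcm. Composing links
from `s` to `u` to `t` is the cube condition (`HeadRel.trans`). It is a finite computation for three
generators, of type A_1^3, A_2 × A_1, B_2 × A_1, A_3 or B_3. That computation itself splits lcms,
but of shorter elements, so one inducts on length (`localLcm_of_le`); the predicate `D` marks the
elements for which splitting is already known.

Number the generators from 0, let P_k be the palindrome centred at x_0 with ends x_k, and Q_k = P_0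
⋯ P_{k-1}. Since P_k commutes with x_i for i < k, Q_{k+1} = Q_k P_k = P_k Q_k is a right multiple of
x_k as well as of the earlier generators. Conversely, for k ≥ 1, if x_k divides Q_k b, then x_k
passes through Q_{k-1} and divides P_{k-1} b, which forces P_k to divide b (`palindrome_succ_dvd`).
So Q_k is the lcm of x_0, …, x_{k-1}. Garside elements are unique because the relations preserve
length, and the relative one is unique by cancelling Q_n in Q_{n+1} = Q_n P_n. -/

namespace CoxeterMatrix

/-! ### Local least common multiples and the cube condition. -/

/-- The map `c ↦ u * c`, where `x * u` is the alternating product of `x` and `y` with `m` factors,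
for `m ≤ 4`. -/
def complement {M : Type*} [Monoid M] (m : ℕ) (x y c : M) : M :=
  match m with
  | 2 => y * c
  | 3 => y * (x * c)
  | 4 => y * (x * (y * c))
  | _ => c

/-- The alternating products of `x` and `y` with `m` factors agree, and every common right multiple
of `x` and `y` satisfying `D` is a multiple of them. -/
structure LocalLcm {M : Type*} [Monoid M] (D : M → Prop) (m : ℕ) (x y : M) : Prop where
  braid : ∀ c, x * complement m x y c = y * complement m y x c
  split : ∀ a b, D (x * a) → x * a = y * b →
    ∃ c, (D a ∧ a = complement m x y c) ∧ D b ∧ b = complement m y x c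

/-- The compatibility of the local least common multiples of three generators: the splittings of
`x * _ = z * _` and `z * _ = y * _` compose to a splitting of `x * _ = y * _`. -/
def Cube {M : Type*} [Monoid M] (D : M → Prop) (p q r : ℕ) (x y z : M) : Prop :=
  ∀ a b, D (complement p z x a) → complement p z x a = complement q z y b →
    ∃ e, complement p x z a = complement r x y e ∧ complement q y z b = complement r y x e

section Cube

variable {M : Type*} [Monoid M] {D : M → Prop} {m p q r : ℕ} {x y z : M}

theorem LocalLcm.symm (h : LocalLcm D m x y) : LocalLcm D m y x where
  braid c := (h.braid c).symm
  split a b d e := by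
    obtain ⟨c, ha, hb⟩ := h.split b a (e ▸ d) e.symm
    exact ⟨c, hb, ha⟩

theorem LocalLcm.cancel (h : LocalLcm D 1 x x) (a b : M) (d : D (x * a)) (e : x * a = x * b) :
    D a ∧ a = b := by
  obtain ⟨c, ⟨da, rfl⟩, -, rfl⟩ := h.split a b d e
  exact ⟨da, rfl⟩

theorem Cube.swap (h : Cube D p q r x y z) : Cube D q p r y x z := by
  intro a b d e
  obtain ⟨c, h1, h2⟩ := h b a (e ▸ d) e.symm
  exact ⟨c, h2, h1⟩

/-- In this and the following cube lemmas, the hypothesis is split repeatedly until one free element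
c remains. The witness e is then the word completing the alternating word of x and y to the lcm of
x, y, z, times c; the rewriting checks the two resulting word identities. -/
theorem cube_two_two_two (hzx : LocalLcm D 2 z x) (hzy : LocalLcm D 2 z y)
    (hxy : LocalLcm D 2 x y) : Cube D 2 2 2 x y z := by
  intro a b d h
  have Bzx := hzx.braid
  have Bzy := hzy.braid
  have Sxy := hxy.split
  simp only [complement] at d h Bzx Bzy Sxy ⊢
  obtain ⟨c1, ⟨-, rfl⟩, ⟨-, rfl⟩⟩ := Sxy _ _ d h
  refine ⟨z * c1, ?_, ?_⟩
  · rw [Bzy c1]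
  · rw [Bzx c1]

theorem cube_two_two_three (hzx : LocalLcm D 2 z x) (hzy : LocalLcm D 2 z y)
    (hxy : LocalLcm D 3 x y) : Cube D 2 2 3 x y z := by
  intro a b d h
  have Bzx := hzx.braid
  have Bzy := hzy.braid
  have Sxy := hxy.split
  simp only [complement] at d h Bzx Bzy Sxy ⊢
  obtain ⟨c1, ⟨-, rfl⟩, ⟨-, rfl⟩⟩ := Sxy _ _ d h
  refine ⟨z * c1, ?_, ?_⟩
  · rw [Bzy (x * c1), Bzx c1]
  · rw [Bzx (y * c1), Bzy c1]

theorem cube_two_two_four (hzx : LocalLcm D 2 z x) (hzy : LocalLcm D 2 z y)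
    (hxy : LocalLcm D 4 x y) : Cube D 2 2 4 x y z := by
  intro a b d h
  have Bzx := hzx.braid
  have Bzy := hzy.braid
  have Sxy := hxy.split
  simp only [complement] at d h Bzx Bzy Sxy ⊢
  obtain ⟨c1, ⟨-, rfl⟩, ⟨-, rfl⟩⟩ := Sxy _ _ d h
  refine ⟨z * c1, ?_, ?_⟩
  · rw [Bzy (x * (y * c1)), Bzx (y * c1), Bzy c1]
  · rw [Bzx (y * (x * c1)), Bzy (x * c1), Bzx c1]

theorem cube_three_two_two (hzx : LocalLcm D 3 z x) (hzy : LocalLcm D 2 z y)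
    (hxy : LocalLcm D 2 x y) : Cube D 3 2 2 x y z := by
  intro a b d h
  have Bzx := hzx.braid
  have Szy := hzy.split
  have Bzy := hzy.braid
  have Sxy := hxy.split
  have Bxy := hxy.braid
  simp only [complement] at d h Bxy Bzx Bzy Sxy Szy ⊢
  obtain ⟨c1, ⟨d1, h1⟩, ⟨-, rfl⟩⟩ := Sxy _ _ d h
  obtain ⟨c2, ⟨-, rfl⟩, ⟨-, rfl⟩⟩ := Szy _ _ d1 h1
  refine ⟨z * (x * c2), ?_, ?_⟩
  · rw [Bxy c2, Bzy (x * c2)]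
  · rw [Bzx c2]

theorem cube_four_two_two (hzx : LocalLcm D 4 z x) (hzy : LocalLcm D 2 z y)
    (hxy : LocalLcm D 2 x y) : Cube D 4 2 2 x y z := by
  intro a b d h
  have Bzx := hzx.braid
  have Szy := hzy.split
  have Bzy := hzy.braid
  have Sxy := hxy.split
  have Bxy := hxy.braid
  simp only [complement] at d h Bxy Bzx Bzy Sxy Szy ⊢
  obtain ⟨c1, ⟨d1, h1⟩, ⟨-, rfl⟩⟩ := Sxy _ _ d h
  obtain ⟨c2, ⟨d2, h2⟩, ⟨-, rfl⟩⟩ := Szy _ _ d1 h1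
  obtain ⟨c3, ⟨-, rfl⟩, ⟨-, rfl⟩⟩ := Sxy _ _ d2 h2
  refine ⟨z * (x * (z * c3)), ?_, ?_⟩
  · rw [Bzy c3, Bxy (z * c3), Bzy (x * (z * c3))]
  · rw [Bzx c3]

theorem cube_three_three_two (hz : LocalLcm D 1 z z) (hzx : LocalLcm D 3 z x)
    (hzy : LocalLcm D 3 z y) (hxy : LocalLcm D 2 x y) : Cube D 3 3 2 x y z := by
  intro a b d h
  have Cz := hz.cancel
  have Szx := hzx.split
  have Bzx := hzx.braid
  have Bxz := hzx.symm.braid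
  have Szy := hzy.split
  have Bzy := hzy.braid
  have Byz := hzy.symm.braid
  have Sxy := hxy.split
  have Bxy := hxy.braid
  have Byx := hxy.symm.braid
  simp only [complement] at d h Bxy Bxz Byx Byz Bzx Bzy Sxy Szx Szy ⊢
  obtain ⟨c1, ⟨d1, h1⟩, ⟨d2, h2⟩⟩ := Sxy _ _ d h
  obtain ⟨c2, ⟨-, rfl⟩, ⟨-, rfl⟩⟩ := Szx _ _ d2 h2
  obtain ⟨c3, ⟨-, rfl⟩, ⟨d3, h3⟩⟩ := Szy _ _ d1 h1
  obtain ⟨d4, h4⟩ := Cz _ _ d3 h3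
  obtain ⟨c4, ⟨-, rfl⟩, ⟨-, rfl⟩⟩ := Sxy _ _ d4 h4
  refine ⟨z * (y * (x * (z * c4))), ?_, ?_⟩
  · rw [Bxy (z * (x * c4)), Bxz c4, Bzy (x * (z * c4))]
  · rw [Byx (z * (y * c4)), Byz c4, Bzx (y * (z * c4)), Bxy (z * c4)]

theorem cube_four_three_two (hx : LocalLcm D 1 x x) (hz : LocalLcm D 1 z z)
    (hzx : LocalLcm D 4 z x) (hzy : LocalLcm D 3 z y) (hxy : LocalLcm D 2 x y) :
    Cube D 4 3 2 x y z := by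
  intro a b d h
  have Cx := hx.cancel
  have Cz := hz.cancel
  have Szx := hzx.split
  have Bzx := hzx.braid
  have Bxz := hzx.symm.braid
  have Szy := hzy.split
  have Bzy := hzy.braid
  have Byz := hzy.symm.braid
  have Sxy := hxy.split
  have Bxy := hxy.braid
  have Syx := hxy.symm.split
  have Byx := hxy.symm.braid
  simp only [complement] at d h Bxy Bxz Byx Byz Bzx Bzy Sxy Syx Szx Szy ⊢
  obtain ⟨c1, ⟨d1, h1⟩, ⟨d2, h2⟩⟩ := Sxy _ _ d h
  obtain ⟨c2, ⟨-, rfl⟩, ⟨-, rfl⟩⟩ := Szx _ _ d2 h2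
  obtain ⟨c3, ⟨d3, h3⟩, ⟨d4, h4⟩⟩ := Szy _ _ d1 h1
  obtain ⟨d5, h5⟩ := Cz _ _ d4 h4
  obtain ⟨c4, ⟨d6, h6⟩, ⟨-, rfl⟩⟩ := Sxy _ _ d5 h5
  obtain ⟨c5, ⟨-, rfl⟩, ⟨-, rfl⟩⟩ := Szy _ _ d6 h6
  obtain ⟨c6, ⟨-, rfl⟩, ⟨d7, h7⟩⟩ := Sxy _ _ d3 h3
  obtain ⟨c7, ⟨d8, h8⟩, ⟨-, rfl⟩⟩ := Szx _ _ d7 h7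
  obtain ⟨d9, h9⟩ := Cx _ _ d8 h8
  obtain ⟨d10, h10⟩ := Cz _ _ d9 h9
  obtain ⟨c8, ⟨-, rfl⟩, ⟨-, rfl⟩⟩ := Syx _ _ d10 h10
  -- The longest element of B_3 has length 9; these seven letters complete x y to it.
  refine ⟨z * (y * (x * (z * (x * (y * (z * c8)))))), ?_, ?_⟩
  · rw [Bzy (x * (z * (y * c8))), Bxy (z * (y * (x * (z * (y * c8))))), Byx (z * (y * c8)),
      Byz c8, Bxz (y * (z * c8)), Bzy (x * (z * (x * (y * (z * c8)))))]
  · rw [Bxy (z * (x * c8)), Byx (z * (y * (x * (z * (x * c8))))), Byz (x * (z * (x * c8))),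
      Bzx c8, Byx (z * (x * (z * c8))), Bzx (y * (z * (x * (z * c8)))), Bzy (x * (z * c8)),
      Bxy (z * (y * (x * (z * c8)))), Byx (z * c8)]

theorem cube_three_two_three (hzx : LocalLcm D 3 z x) (hzy : LocalLcm D 2 z y)
    (hxy : LocalLcm D 3 x y) : Cube D 3 2 3 x y z := by
  intro a b d h
  have Bzx := hzx.braid
  have Sxz := hzx.symm.split
  have Szy := hzy.split
  have Bzy := hzy.braid
  have Byz := hzy.symm.braid
  have Sxy := hxy.split
  have Bxy := hxy.braid
  simp only [complement] at d h Bxy Byz Bzx Bzy Sxy Sxz Szy ⊢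
  obtain ⟨c1, ⟨d1, h1⟩, ⟨-, rfl⟩⟩ := Sxy _ _ d h
  obtain ⟨c2, ⟨-, rfl⟩, ⟨d2, h2⟩⟩ := Szy _ _ d1 h1
  obtain ⟨c3, ⟨-, rfl⟩, ⟨-, rfl⟩⟩ := Sxz _ _ d2 h2
  refine ⟨z * (x * (y * c3)), ?_, ?_⟩
  · rw [Bxy (z * c3), Byz c3, Bzy (x * (z * (y * c3))), Bzx (y * c3)]
  · rw [Byz (x * c3), Bzx (y * (x * c3)), Bxy c3, Bzy (x * (y * c3))]

theorem cube_three_two_four (hzx : LocalLcm D 3 z x) (hzy : LocalLcm D 2 z y)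
    (hxy : LocalLcm D 4 x y) : Cube D 3 2 4 x y z := by
  intro a b d h
  have Bzx := hzx.braid
  have Sxz := hzx.symm.split
  have Bxz := hzx.symm.braid
  have Szy := hzy.split
  have Bzy := hzy.braid
  have Syz := hzy.symm.split
  have Byz := hzy.symm.braid
  have Sxy := hxy.split
  have Bxy := hxy.braid
  simp only [complement] at d h Bxy Bxz Byz Bzx Bzy Sxy Sxz Syz Szy ⊢
  obtain ⟨c1, ⟨d1, h1⟩, ⟨-, rfl⟩⟩ := Sxy _ _ d h
  obtain ⟨c2, ⟨-, rfl⟩, ⟨d2, h2⟩⟩ := Szy _ _ d1 h1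
  obtain ⟨c3, ⟨d3, h3⟩, ⟨-, rfl⟩⟩ := Sxz _ _ d2 h2
  obtain ⟨c4, ⟨-, rfl⟩, ⟨d4, h4⟩⟩ := Syz _ _ d3 h3
  obtain ⟨c5, ⟨-, rfl⟩, ⟨-, rfl⟩⟩ := Sxy _ _ d4 h4
  refine ⟨z * (x * (y * (x * (z * c5)))), ?_, ?_⟩
  · rw [Bzy (x * (y * c5)), Bxy (z * (x * (y * c5))), Bxz (y * c5), Byz (x * (z * (y * c5))),
      Bzy (x * (z * (y * (x * (z * (y * c5)))))), Bzx (y * (x * (z * (y * c5)))), Bzy c5,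
      Bxy (z * c5), Bzy (x * (y * (x * (z * c5))))]
  · rw [Bxz (y * (x * c5)), Byz (x * (z * (y * (x * c5)))),
      Bzx (y * (x * (z * (y * (x * c5))))), Bzy (x * c5), Bxy (z * (x * c5)), Bxz c5,
      Byz (x * (z * c5)), Bzy (x * (z * (y * (x * (z * c5))))), Bzx (y * (x * (z * c5)))]

theorem cube_four_two_three (hx : LocalLcm D 1 x x) (hzx : LocalLcm D 4 z x)
    (hzy : LocalLcm D 2 z y) (hxy : LocalLcm D 3 x y) : Cube D 4 2 3 x y z := by
  intro a b d h
  have Cx := hx.cancel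
  have Bzx := hzx.braid
  have Sxz := hzx.symm.split
  have Szy := hzy.split
  have Bzy := hzy.braid
  have Byz := hzy.symm.braid
  have Sxy := hxy.split
  have Bxy := hxy.braid
  have Byx := hxy.symm.braid
  simp only [complement] at d h Bxy Byx Byz Bzx Bzy Sxy Sxz Szy ⊢
  obtain ⟨c1, ⟨d1, h1⟩, ⟨-, rfl⟩⟩ := Sxy _ _ d h
  obtain ⟨c2, ⟨d2, h2⟩, ⟨d3, h3⟩⟩ := Szy _ _ d1 h1
  obtain ⟨c3, ⟨-, rfl⟩, ⟨-, rfl⟩⟩ := Sxz _ _ d3 h3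
  obtain ⟨c4, ⟨-, rfl⟩, ⟨d4, h4⟩⟩ := Sxy _ _ d2 h2
  obtain ⟨d5, h5⟩ := Cx _ _ d4 h4
  obtain ⟨c5, ⟨d6, h6⟩, ⟨-, rfl⟩⟩ := Szy _ _ d5 h5
  obtain ⟨c6, ⟨-, rfl⟩, ⟨-, rfl⟩⟩ := Sxy _ _ d6 h6
  refine ⟨z * (x * (z * (y * (x * (z * c6))))), ?_, ?_⟩
  · rw [Bzy (x * (z * (x * (y * c6)))), Bzx (y * c6), Bxy (z * (x * (z * (y * c6)))),
      Byz (x * (z * (y * c6))), Bzy (x * (z * (y * (x * (z * (y * c6)))))), Bzy c6,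
      Byx (z * c6), Bzx (y * (x * (z * c6)))]
  · rw [Byz (x * (z * (y * (x * c6)))), Bzy (x * c6), Byx (z * (x * c6)),
      Bzx (y * (x * (z * (x * c6)))), Bzy (x * (z * (x * c6))), Bzx c6,
      Bxy (z * (x * (z * c6))), Byz (x * (z * c6)), Bzy (x * (z * (y * (x * (z * c6)))))]

end Cube

universe u

/-! ### Length and antisymmetry of divisibility. -/

section Length

variable {S : Type u} (M : CoxeterMatrix S)

/-- The length homomorphism of the Artin monoid. -/
def artinLength : M.ArtinMonoid →* Multiplicative ℕ :=
  PresentedMonoid.lift (fun _ ↦ Multiplicative.ofAdd 1) (by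
    rintro _ _ ⟨s, t, -⟩
    simp [FreeMonoid.lift_apply, CoxeterSystem.length_alternatingWord, M.symmetric s t])

/-- The common length of all words representing an element of the Artin monoid. -/
def wordLength (a : M.ArtinMonoid) : ℕ := (M.artinLength a).toAdd

theorem wordLength_mul (a b : M.ArtinMonoid) :
    M.wordLength (a * b) = M.wordLength a + M.wordLength b := by
  simp [wordLength]

theorem wordLength_artinGen (s : S) : M.wordLength (M.artinGen s) = 1 := rfl

theorem wordLength_artinWord (w : List S) : M.wordLength (M.artinWord w) = w.length := by
  induction w with
  | nil => simp [wordLength, artinWord]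
  | cons s w ih =>
    rw [artinWord, List.map_cons, List.prod_cons, wordLength_mul, wordLength_artinGen,
      ← artinWord, ih, List.length_cons, add_comm]

theorem exists_artinWord (a : M.ArtinMonoid) : ∃ w, a = M.artinWord w := by
  obtain ⟨w, rfl⟩ := PresentedMonoid.surjective_mk a
  exact ⟨w.toList, (M.artinWord_eq_mk _).symm⟩

theorem artinWord_cons (s : S) (w : List S) :
    M.artinWord (s :: w) = M.artinGen s * M.artinWord w := rfl

theorem artinWord_append (v w : List S) :
    M.artinWord (v ++ w) = M.artinWord v * M.artinWord w := by
  simp [artinWord]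

theorem eq_one_of_wordLength_eq_zero {a : M.ArtinMonoid} (h : M.wordLength a = 0) : a = 1 := by
  obtain ⟨w, rfl⟩ := M.exists_artinWord a
  rw [wordLength_artinWord, List.length_eq_zero_iff] at h
  rw [h]
  rfl

theorem dvd_antisymm {a b : M.ArtinMonoid} (hab : a ∣ b) (hba : b ∣ a) : a = b := by
  obtain ⟨c, rfl⟩ := hab
  obtain ⟨d, hd⟩ := hba
  have h := congrArg M.wordLength hd
  simp only [wordLength_mul] at h
  rw [M.eq_one_of_wordLength_eq_zero (a := c) (by omega), mul_one]

end Length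

/-! ### From the cube condition to lcms of generators. -/

section Reduction

variable {S : Type u} {M : CoxeterMatrix S}

/-- Two words are both empty, or their first letters `s`, `t` split off the local least common
multiple of `s` and `t`. -/
inductive HeadRel (M : CoxeterMatrix S) : List S → List S → Prop
  | nil : HeadRel M [] []
  | cons (s t : S) (v w : List S) (c : M.ArtinMonoid)
      (hv : M.artinWord v = complement (M s t) (M.artinGen s) (M.artinGen t) c)
      (hw : M.artinWord w = complement (M s t) (M.artinGen t) (M.artinGen s) c) :
      HeadRel M (s :: v) (t :: w)

theorem HeadRel.refl (w : List S) : HeadRel M w w := by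
  cases w with
  | nil => exact .nil
  | cons s w =>
    refine .cons s s w w (M.artinWord w) ?_ ?_ <;> simp [complement]

theorem HeadRel.symm {v w : List S} (h : HeadRel M v w) : HeadRel M w v := by
  cases h with
  | nil => exact .nil
  | cons s t v w c hv hw => exact .cons t s w v c (M.symmetric s t ▸ hw) (M.symmetric s t ▸ hv)

theorem complement_mul {N : Type*} [Monoid N] (m : ℕ) (x y c d : N) :
    complement m x y c * d = complement m x y (c * d) := by
  unfold complement
  split <;> simp only [mul_assoc]

theorem complement_cancel {N : Type*} [Monoid N] {D : N → Prop} {m : ℕ} {x y c d : N}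
    (hx : LocalLcm D 1 x x) (hy : LocalLcm D 1 y y) (hD : D (complement m x y c))
    (h : complement m x y c = complement m x y d) : c = d := by
  unfold complement at hD h
  split at hD
  · exact (hy.cancel _ _ hD h).2
  · obtain ⟨hD, h⟩ := hy.cancel _ _ hD h
    exact (hx.cancel _ _ hD h).2
  · obtain ⟨hD, h⟩ := hy.cancel _ _ hD h
    obtain ⟨hD, h⟩ := hx.cancel _ _ hD h
    exact (hy.cancel _ _ hD h).2
  · split at h
    all_goals first | contradiction | exact h

theorem mul_complement_artinGen (h : ∀ s t, M s t = 1 ∨ M s t = 2 ∨ M s t = 3 ∨ M s t = 4)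
    (s t : S) (c : M.ArtinMonoid) :
    M.artinGen s * complement (M s t) (M.artinGen s) (M.artinGen t) c =
      M.artinGen t * complement (M s t) (M.artinGen t) (M.artinGen s) c := by
  obtain hm | hm := eq_or_ne (M s t) 1
  · obtain rfl : s = t := by by_contra hne; exact M.off_diagonal s t hne hm
    rfl
  · have key := M.artinWord_braidWord s t (by have := h s t; omega)
    have hm' := M.symmetric s t
    have hs := h s t
    rcases hs with hs | hs | hs | hs
    · exact absurd hs hm
    all_goals
      rw [CoxeterSystem.braidWord, CoxeterSystem.braidWord, ← hm', hs] at key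
      replace key := congrArg (· * c) key
      simp only [CoxeterSystem.alternatingWord, artinWord, List.concat_eq_append, List.nil_append,
        List.cons_append, List.map_cons, List.map_nil, List.prod_cons, List.prod_nil, mul_one,
        mul_assoc] at key
      simp only [hs, complement]
      first | exact key | exact key.symm

theorem HeadRel.braid (h : ∀ s t, M s t = 1 ∨ M s t = 2 ∨ M s t = 3 ∨ M s t = 4) (s t : S) :
    HeadRel M (CoxeterSystem.braidWord M s t) (CoxeterSystem.braidWord M t s) := by
  obtain hm | hm := eq_or_ne (M s t) 1
  · obtain rfl : s = t := by by_contra hne; exact M.off_diagonal s t hne hm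
    exact .refl _
  · have hm' := M.symmetric s t
    have hs := h s t
    rcases hs with hs | hs | hs | hs
    · exact absurd hs hm
    all_goals
      rw [CoxeterSystem.braidWord, CoxeterSystem.braidWord, ← hm', hs]
      refine .cons _ _ _ _ 1 ?_ ?_ <;>
      simp [hs, ← hm', complement, artinWord]

/-- Every triple of distinct vertices satisfies the cube condition for a suitable class of
elements. -/
def CubeCondition (M : CoxeterMatrix S) : Prop :=
  ∀ D : M.ArtinMonoid → Prop, (∀ s t, LocalLcm D (M s t) (M.artinGen s) (M.artinGen t)) →
    ∀ s t u, s ≠ t → u ≠ s → u ≠ t →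
      Cube D (M u s) (M u t) (M s t) (M.artinGen s) (M.artinGen t) (M.artinGen u)

/-- The tail of the middle word has two expressions, one from each link. Comparing them needs
cancellation or the cube condition only for that tail, whose length is at most `L`. -/
theorem HeadRel.trans {v w z : List S} (hM : M.CubeCondition) {L : ℕ}
    (hD : ∀ s t, LocalLcm (fun a ↦ M.wordLength a ≤ L) (M s t) (M.artinGen s) (M.artinGen t))
    (hw : w.length ≤ L + 1) (h1 : HeadRel M v w) (h2 : HeadRel M w z) : HeadRel M v z := by
  cases h1 with
  | nil => exact h2
  | cons s u v w c hv hw1 =>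
    cases h2 with
    | cons _ t _ z d hw2 hz =>
    have hlen : M.wordLength (M.artinWord w) ≤ L := by
      rw [wordLength_artinWord]
      simpa using hw
    obtain rfl | hus := eq_or_ne u s
    · rw [M.diagonal] at hv hw1
      rw [show M.artinWord w = M.artinWord v from hw1.trans hv.symm] at hw2
      exact .cons u t v z d hw2 hz
    obtain rfl | hut := eq_or_ne u t
    · rw [M.diagonal] at hw2 hz
      rw [show M.artinWord w = M.artinWord z from hw2.trans hz.symm] at hw1
      exact .cons s u v z c hv hw1
    rw [M.symmetric s u] at hv hw1
    obtain rfl | hst := eq_or_ne s t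
    -- The outer letters agree but the middle one differs: cancellation identifies the two
    -- cofactors, so the outer tails represent the same element.
    · have hu := hD u u
      have hs := hD s s
      rw [M.diagonal] at hu hs
      obtain rfl := complement_cancel hu hs (hw1 ▸ hlen) (hw1.symm.trans hw2)
      refine .cons s s v z (M.artinWord v) ?_ ?_ <;> rw [M.diagonal] <;>
      simp only [complement, hv, hz]
    · have := hM _ hD s t u hst hus hut c d (hw1 ▸ hlen) (hw1.symm.trans hw2)
      obtain ⟨e, h1, h2⟩ := this
      exact .cons s t v z e (hv.trans h1) (hz.trans (h2))

theorem headRel_of_conGen (h4 : ∀ s t, M s t = 1 ∨ M s t = 2 ∨ M s t = 3 ∨ M s t = 4)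
    (hM : M.CubeCondition) {L : ℕ}
    (hD : ∀ s t, LocalLcm (fun a ↦ M.wordLength a ≤ L) (M s t) (M.artinGen s) (M.artinGen t))
    {v w : FreeMonoid S} (h : ConGen.Rel M.ArtinRel v w) (hv : v.toList.length ≤ L + 1) :
    HeadRel M v.toList w.toList := by
  have eqv {v w : FreeMonoid S} (h : ConGen.Rel M.ArtinRel v w) :
      M.artinWord v.toList = M.artinWord w.toList := by
    rw [artinWord_eq_mk, artinWord_eq_mk]
    exact PresentedMonoid.mk_eq_mk_iff.2 h
  have len {v w : FreeMonoid S} (h : ConGen.Rel M.ArtinRel v w) :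
      v.toList.length = w.toList.length := by
    rw [← M.wordLength_artinWord, ← M.wordLength_artinWord, eqv h]
  induction h with
  | of _ _ h =>
    obtain ⟨s, t, -⟩ := h
    exact .braid h4 s t
  | refl => exact .refl _
  | symm h ih => exact (ih ((len h).trans_le hv)).symm
  | trans h1 h2 ih1 ih2 =>
    have := (len h1).symm.trans_le hv
    exact (ih1 hv).trans hM hD this (ih2 this)
  | @mul w x y z h1 h2 ih1 ih2 =>
    rw [FreeMonoid.toList_mul, List.length_append] at hv
    have e := ih1 (by omega)
    have f := ih2 (by omega)
    rw [FreeMonoid.toList_mul, FreeMonoid.toList_mul]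
    generalize w.toList = w at e
    generalize x.toList = x at e
    cases e with
    | nil => simpa
    | cons s t v w c hv hw =>
      -- The first factors are nonempty and supply both heads; the second factors, equal in the
      -- monoid, are absorbed into the cofactor.
      refine .cons s t _ _ (c * M.artinWord y.toList) ?_ ?_
      · rw [List.append_eq, artinWord_append, hv, complement_mul]
      · rw [List.append_eq, artinWord_append, hw, complement_mul, eqv h2]

/-- Removing the first letter lowers the length by one, so splitting up to length `L` gives
transitivity of `HeadRel` on words of length `L + 1`, hence splitting there. At `L = 0` nothing is
to be split, as a multiple of a generator has positive length. -/
theorem localLcm_of_le (h4 : ∀ s t, M s t = 1 ∨ M s t = 2 ∨ M s t = 3 ∨ M s t = 4)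
    (hM : M.CubeCondition) (L : ℕ) (s t : S) :
    LocalLcm (fun a ↦ M.wordLength a ≤ L) (M s t) (M.artinGen s) (M.artinGen t) := by
  induction L generalizing s t with
  | zero =>
    refine ⟨mul_complement_artinGen h4 s t, fun a b h ↦ ?_⟩
    rw [wordLength_mul, wordLength_artinGen] at h
    omega
  | succ L ih =>
    refine ⟨mul_complement_artinGen h4 s t, fun a b h e ↦ ?_⟩
    obtain ⟨v, rfl⟩ := M.exists_artinWord a
    obtain ⟨w, rfl⟩ := M.exists_artinWord b
    have hab := congrArg M.wordLength e
    rw [← artinWord_cons, ← artinWord_cons, artinWord_eq_mk, artinWord_eq_mk] at e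
    simp only [wordLength_mul, wordLength_artinGen, wordLength_artinWord] at h hab ⊢
    have := headRel_of_conGen h4 hM ih (PresentedMonoid.mk_eq_mk_iff.1 e)
      (by simp only [FreeMonoid.toList_ofList, List.length_cons]; omega)
    simp only [FreeMonoid.toList_ofList] at this
    cases this with
    | cons _ _ _ _ c hv hw => exact ⟨c, ⟨by omega, hv⟩, by omega, hw⟩

theorem localLcm (h4 : ∀ s t, M s t = 1 ∨ M s t = 2 ∨ M s t = 3 ∨ M s t = 4)
    (hM : M.CubeCondition) (s t : S) :
    LocalLcm (fun _ ↦ True) (M s t) (M.artinGen s) (M.artinGen t) := by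
  refine ⟨mul_complement_artinGen h4 s t, fun a b _ e ↦ ?_⟩
  obtain ⟨c, ⟨-, ha⟩, -, hb⟩ := (localLcm_of_le h4 hM _ s t).split a b le_rfl e
  exact ⟨c, ⟨trivial, ha⟩, trivial, hb⟩

end Reduction

/-! ### The cube condition for type B. -/

section TypeB

theorem typeB_le_four {n : ℕ} (s t : Fin n) :
    typeB n s t = 1 ∨ typeB n s t = 2 ∨ typeB n s t = 3 ∨ typeB n s t = 4 := by
  rw [typeB_apply]
  split_ifs <;> simp

theorem typeB_trichotomy {n : ℕ} {i j : Fin n} (h : i ≠ j) :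
    (typeB n i j = 2 ∧ (i : ℕ) + 1 ≠ j ∧ (j : ℕ) + 1 ≠ i) ∨
    (typeB n i j = 3 ∧ ((i : ℕ) + 1 = j ∨ (j : ℕ) + 1 = i) ∧ (i : ℕ) ≠ 0 ∧ (j : ℕ) ≠ 0) ∨
    (typeB n i j = 4 ∧ ((i : ℕ) + 1 = j ∨ (j : ℕ) + 1 = i) ∧ ((i : ℕ) = 0 ∨ (j : ℕ) = 0)) := by
  rw [typeB_apply, if_neg h]
  split_ifs with h1 h2
  · exact .inr (.inr ⟨rfl, h1, h2⟩)
  · exact .inr (.inl ⟨rfl, h1, not_or.1 h2⟩)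
  · exact .inl ⟨rfl, not_or.1 h1⟩

theorem cubeCondition_typeB (n : ℕ) : (typeB n).CubeCondition := by
  intro D hD s t u hst hus hut
  have hd (i : Fin n) : LocalLcm D 1 ((typeB n).artinGen i) ((typeB n).artinGen i) := by
    have := hD i i
    rwa [(typeB n).diagonal] at this
  have hs := hd s
  have ht := hd t
  have hu := hd u
  have h1 := hD u s
  have h2 := hD u t
  have h3 := hD s t
  have h4 := h3.symm
  obtain ⟨p, hp⟩ : ∃ p, typeB n u s = p := ⟨_, rfl⟩
  obtain ⟨q, hq⟩ : ∃ q, typeB n u t = q := ⟨_, rfl⟩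
  obtain ⟨r, hr⟩ : ∃ r, typeB n s t = r := ⟨_, rfl⟩
  rw [hp] at h1 ⊢
  rw [hq] at h2 ⊢
  rw [hr] at h3 h4 ⊢
  -- A path contains no triangle and only its first edge is labelled 4. Among the 27 label patterns,
  -- `decide` accepts the listed ones and `omega` excludes the others by adjacency.
  have key : (p = 2 ∧ q = 2 ∧ (r = 2 ∨ r = 3 ∨ r = 4)) ∨ (r = 2 ∧ q = 2 ∧ (p = 3 ∨ p = 4)) ∨
      (r = 2 ∧ p = 2 ∧ (q = 3 ∨ q = 4)) ∨
      (r = 2 ∧ (p = 3 ∧ q = 3 ∨ p = 4 ∧ q = 3 ∨ p = 3 ∧ q = 4)) ∨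
      (q = 2 ∧ (p = 3 ∧ r = 3 ∨ p = 4 ∧ r = 3 ∨ p = 3 ∧ r = 4)) ∨
      (p = 2 ∧ (q = 3 ∧ r = 3 ∨ q = 4 ∧ r = 3 ∨ q = 3 ∧ r = 4)) := by
    have hp' := typeB_trichotomy hus
    have hq' := typeB_trichotomy hut
    have hr' := typeB_trichotomy hst
    rw [hp] at hp'
    rw [hq] at hq'
    rw [hr] at hr'
    clear hp hq hr h1 h2 h3 h4
    simp only [ne_eq, Fin.ext_iff] at hst hus hut
    rcases hp' with ⟨rfl, hp⟩ | ⟨rfl, hp⟩ | ⟨rfl, hp⟩ <;>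
    rcases hq' with ⟨rfl, hq⟩ | ⟨rfl, hq⟩ | ⟨rfl, hq⟩ <;>
    rcases hr' with ⟨rfl, hr⟩ | ⟨rfl, hr⟩ | ⟨rfl, hr⟩ <;>
    first
    | decide
    | omega
  rcases key with ⟨rfl, rfl, rfl | rfl | rfl⟩ | ⟨rfl, rfl, rfl | rfl⟩ | ⟨rfl, rfl, rfl | rfl⟩ |
    ⟨rfl, ⟨rfl, rfl⟩ | ⟨rfl, rfl⟩ | ⟨rfl, rfl⟩⟩ | ⟨rfl, ⟨rfl, rfl⟩ | ⟨rfl, rfl⟩ | ⟨rfl, rfl⟩⟩ |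
    ⟨rfl, ⟨rfl, rfl⟩ | ⟨rfl, rfl⟩ | ⟨rfl, rfl⟩⟩
  · exact cube_two_two_two h1 h2 h3
  · exact cube_two_two_three h1 h2 h3
  · exact cube_two_two_four h1 h2 h3
  · exact cube_three_two_two h1 h2 h3
  · exact cube_four_two_two h1 h2 h3
  · exact (cube_three_two_two h2 h1 h4).swap
  · exact (cube_four_two_two h2 h1 h4).swap
  · exact cube_three_three_two hu h1 h2 h3
  · exact cube_four_three_two hs hu h1 h2 h3
  · exact (cube_four_three_two ht hu h2 h1 h4).swap
  · exact cube_three_two_three h1 h2 h3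
  · exact cube_four_two_three hs h1 h2 h3
  · exact cube_three_two_four h1 h2 h3
  · exact (cube_three_two_three h2 h1 h4).swap
  · exact (cube_four_two_three ht h2 h1 h4).swap
  · exact (cube_three_two_four h2 h1 h4).swap

end TypeB

/-! ### Palindromes and the lcm of the generators. -/

section Palindrome

/-- A sequence of elements of a monoid whose first `n` terms satisfy the braid relations of
type `B`, these being least common right multiples. -/
structure TypeBSequence {N : Type*} [Monoid N] (n : ℕ) (x : ℕ → N) : Prop where
  one : ∀ i < n, LocalLcm (fun _ ↦ True) 1 (x i) (x i)
  two : ∀ i j, i + 1 < j → j < n → LocalLcm (fun _ ↦ True) 2 (x i) (x j)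
  three : ∀ i, i + 2 < n → LocalLcm (fun _ ↦ True) 3 (x (i + 1)) (x (i + 2))
  four : 1 < n → LocalLcm (fun _ ↦ True) 4 (x 0) (x 1)

/-- The element `x_k ⋯ x_1 x_0 x_1 ⋯ x_k`. -/
def palindrome {N : Type*} [Monoid N] (x : ℕ → N) : ℕ → N
  | 0 => x 0
  | k + 1 => x (k + 1) * palindrome x k * x (k + 1)

/-- The product of the first `k` palindromes. -/
def palindromeProd {N : Type*} [Monoid N] (x : ℕ → N) : ℕ → N
  | 0 => 1
  | k + 1 => palindromeProd x k * palindrome x k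

/-- Every common right multiple of `u` and `y` is a right multiple of both `u * y` and `y * u`, in
the form obtained after cancelling `u` and `y` on the left. -/
def Passes {N : Type*} [Monoid N] (y u : N) : Prop :=
  ∀ a b, u * a = y * b → ∃ c, a = y * c ∧ b = u * c

variable {N : Type*} [Monoid N] {x : ℕ → N} {n : ℕ} {y u v : N}

theorem Passes.mul (hu : Passes y u) (hv : Passes y v) : Passes y (u * v) := by
  intro a b h
  rw [mul_assoc] at h
  obtain ⟨c, hc, rfl⟩ := hu _ _ h
  obtain ⟨d, rfl, rfl⟩ := hv _ _ hc
  exact ⟨d, rfl, (mul_assoc _ _ _).symm⟩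

theorem Passes.one : Passes y (1 : N) := fun a b h ↦ ⟨b, by simpa using h, by simp⟩

theorem LocalLcm.passes (h : LocalLcm (fun _ ↦ True) 2 u y) : Passes y u := by
  intro a b e
  obtain ⟨c, ⟨-, rfl⟩, -, rfl⟩ := h.split a b trivial e
  exact ⟨c, rfl, rfl⟩

theorem LocalLcm.commute {D : N → Prop} (h : LocalLcm D 2 u y) : Commute u y := by
  simpa [complement, Commute, SemiconjBy] using h.braid 1

namespace TypeBSequence

theorem commute_palindrome_of_lt (hx : TypeBSequence n x) {k j : ℕ} (hkj : k + 1 < j)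
    (hj : j < n) : Commute (x j) (palindrome x k) := by
  induction k with
  | zero => exact (hx.two 0 j hkj hj).commute.symm
  | succ k ih =>
    have h := (hx.two (k + 1) j hkj hj).commute.symm
    exact (h.mul_right (ih (by omega))).mul_right h

theorem passes_palindrome (hx : TypeBSequence n x) {k j : ℕ} (hkj : k + 1 < j)
    (hj : j < n) : Passes (x j) (palindrome x k) := by
  induction k with
  | zero => exact (hx.two 0 j hkj hj).passes
  | succ k ih =>
    have h := (hx.two (k + 1) j hkj hj).passes
    exact (h.mul (ih (by omega))).mul h

theorem passes_palindromeProd (hx : TypeBSequence n x) {k j : ℕ} (hkj : k < j)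
    (hj : j < n) : Passes (x j) (palindromeProd x k) := by
  induction k with
  | zero => exact .one
  | succ k ih => exact (ih (by omega)).mul (hx.passes_palindrome hkj hj)

theorem commute_palindrome (hx : TypeBSequence n x) {i k : ℕ} (hik : i < k) (hk : k < n) :
    Commute (x i) (palindrome x k) := by
  induction k with
  | zero => omega
  | succ k ih =>
    obtain hik | rfl := Nat.lt_succ_iff_lt_or_eq.1 hik
    · have h := (hx.two i (k + 1) (by omega) hk).commute
      exact (h.mul_right (ih hik (by omega))).mul_right h
    · cases i with
      | zero => simpa [complement, palindrome, Commute, SemiconjBy, mul_assoc] using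
          (hx.four hk).braid 1
      | succ i =>
        have B : ∀ c, x (i + 1) * (x (i + 2) * (x (i + 1) * c)) =
          x (i + 2) * (x (i + 1) * (x (i + 2) * c)) := (hx.three i hk).braid
        have C := (hx.commute_palindrome_of_lt (k := i) (j := i + 2) (by omega) hk).eq
        have C' (c : N) : x (i + 2) * (palindrome x i * c) = palindrome x i * (x (i + 2) * c) := by
          rw [← mul_assoc, C, mul_assoc]
        have B1 := B 1
        rw [mul_one, mul_one] at B1
        simp only [palindrome, Commute, SemiconjBy, mul_assoc]
        -- Braid on the left, carry x_{i+2} through P_i, then braid backwards on the right: x_{i+1}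
        -- emerges at the far end.
        rw [B, C', ← B1]

theorem commute_palindromeProd (hx : TypeBSequence n x) {i k : ℕ} (hik : i ≤ k) (hk : k < n) :
    Commute (palindromeProd x i) (palindrome x k) := by
  have aux : ∀ j < i, Commute (palindrome x j) (palindrome x k) := by
    intro j hj
    induction j with
    | zero => exact hx.commute_palindrome (by omega) hk
    | succ j ih =>
      have h := hx.commute_palindrome (i := j + 1) (by omega) hk
      exact (h.mul_left (ih (by omega))).mul_left h
  clear hik
  induction i with
  | zero => exact Commute.one_left _
  | succ i ih => exact (ih fun j hj ↦ aux j (by omega)).mul_left (aux i (by omega))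

theorem dvd_palindrome (k : ℕ) : x k ∣ palindrome x k := by
  cases k with
  | zero => exact dvd_rfl
  | succ k => exact ⟨palindrome x k * x (k + 1), mul_assoc _ _ _⟩

theorem dvd_palindromeProd (hx : TypeBSequence n x) {i k : ℕ} (hik : i < k) (hk : k ≤ n) :
    x i ∣ palindromeProd x k := by
  induction k with
  | zero => omega
  | succ k ih =>
    obtain hik | rfl := Nat.lt_succ_iff_lt_or_eq.1 hik
    · exact (ih hik (by omega)).trans (Dvd.intro _ rfl)
    · rw [palindromeProd, (hx.commute_palindromeProd le_rfl hk).eq]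
      exact (dvd_palindrome i).trans (Dvd.intro _ rfl)

/-- The base case is the relation of length 4. For the step, peel off the outer letters of P_{k+1}
with the length 3 relation, using that x_{k+2} passes through P_k. -/
theorem palindrome_succ_dvd (hx : TypeBSequence n x) {k : ℕ} (hk : k + 1 < n) {a b : N}
    (h : palindrome x k * a = x (k + 1) * b) : palindrome x (k + 1) ∣ a := by
  induction k generalizing a b with
  | zero =>
    obtain ⟨c, ⟨-, rfl⟩, -⟩ := (hx.four hk).split a b trivial h
    exact ⟨c, by simp [complement, palindrome, mul_assoc]⟩
  | succ k ih =>
    have H := hx.three k hk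
    have P := hx.passes_palindrome (k := k) (j := k + 2) (by omega) hk
    rw [palindrome, mul_assoc, mul_assoc] at h
    obtain ⟨c, ⟨-, h1⟩, -⟩ := H.split _ _ trivial h
    obtain ⟨d, h2, h3⟩ := P _ _ h1
    -- Here P_k d = x_{k+1} c, so induction gives d = P_{k+1} e. The remaining splittings determine
    -- a from the inside out, ending at a = P_{k+2} i.
    obtain ⟨e, rfl⟩ := ih (by omega) h3.symm
    obtain ⟨f, ⟨-, rfl⟩, -, h4⟩ := H.split _ _ trivial h2
    have h5 : x (k + 1) * (palindrome x k * (x (k + 1) * e)) = x (k + 1) * (x (k + 2) * f) := by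
      simpa [palindrome, complement, mul_assoc] using h4
    obtain ⟨-, h6⟩ := (hx.one (k + 1) (by omega)).cancel _ _ trivial h5
    obtain ⟨g, h7, rfl⟩ := P _ _ h6
    obtain ⟨i, -, -, rfl⟩ := H.split _ _ trivial h7
    exact ⟨i, by simp [complement, palindrome, mul_assoc]⟩

theorem palindromeProd_dvd (hx : TypeBSequence n x) {k : ℕ} (hk : k ≤ n) {a : N}
    (h : ∀ i < k, x i ∣ a) : palindromeProd x k ∣ a := by
  induction k with
  | zero => exact one_dvd _
  | succ k ih =>
    obtain ⟨b, rfl⟩ := ih (by omega) fun i hi ↦ h i (by omega)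
    obtain ⟨c, hc⟩ := h k (by omega)
    refine mul_dvd_mul_left _ ?_
    cases k with
    | zero => exact ⟨c, by simpa [palindromeProd, palindrome] using hc⟩
    | succ k =>
      rw [palindromeProd, mul_assoc] at hc
      -- All factors of Q_k except the last one, P_k, involve only generators of index less than k,
      -- so x_{k+1} passes through them.
      obtain ⟨d, h1, -⟩ := hx.passes_palindromeProd (k := k) (j := k + 1) (by omega) hk _ _ hc
      exact hx.palindrome_succ_dvd hk h1

end TypeBSequence

end Palindrome

/-! ### Translation to words, Garside elements and cancellation. -/

section TypeBWords

theorem map_val_palindromeWord {n : ℕ} (k : Fin n) :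
    (palindromeWord k).map Fin.val =
      (List.range (k + 1)).reverse ++ (List.range (k + 1)).tail := by
  have h : ((List.finRange n).filter (· ≤ k)).map Fin.val = List.range (k + 1) := by
    have h1 := List.filter_map (f := Fin.val) (p := fun i ↦ decide (i ≤ (k : ℕ)))
      (l := List.finRange n)
    rw [List.map_coe_finRange_eq_range] at h1
    have h2 : ((List.finRange n).filter (· ≤ k)).map Fin.val =
      (List.range n).filter (· ≤ (k : ℕ)) := h1.symm
    obtain ⟨m, hm⟩ := Nat.exists_eq_add_of_le (Nat.succ_le_of_lt k.2)
    rw [h2, show List.range n = List.range (k + 1 + m) from congrArg _ hm, List.range_add,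
      List.filter_append, List.filter_eq_self.2, List.filter_eq_nil_iff.2, List.append_nil]
    · simp
      omega
    · simp
  rw [palindromeWord, List.map_append, List.map_reverse, List.map_tail, h]

theorem map_val_garsideWordB (n : ℕ) :
    (garsideWordB n).map Fin.val = (List.range n).flatMap fun k ↦
      (List.range (k + 1)).reverse ++ (List.range (k + 1)).tail := by
  rw [garsideWordB, List.map_flatMap, ← List.map_coe_finRange_eq_range, List.flatMap_map]
  simp only [map_val_palindromeWord]

theorem prod_map_range_palindrome {N : Type*} [Monoid N] (x : ℕ → N) (k : ℕ) :
    (((List.range (k + 1)).reverse ++ (List.range (k + 1)).tail).map x).prod =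
      palindrome x k := by
  induction k with
  | zero => simp [palindrome]
  | succ k ih =>
    rw [List.range_succ, List.tail_append_of_ne_nil (by simp), palindrome, ← ih]
    simp [mul_assoc]

theorem prod_map_range_palindromeProd {N : Type*} [Monoid N] (x : ℕ → N) (n : ℕ) :
    (((List.range n).flatMap fun k ↦
      (List.range (k + 1)).reverse ++ (List.range (k + 1)).tail).map x).prod =
      palindromeProd x n := by
  induction n with
  | zero => simp [palindromeProd]
  | succ n ih =>
    rw [List.range_succ, List.flatMap_append, List.map_append, List.prod_append, ih,
      List.flatMap_singleton, prod_map_range_palindrome, palindromeProd]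

/-- The generators of the Artin monoid of type `B_n`, as a sequence extended by `1`. -/
def genSeq (n i : ℕ) : (typeB n).ArtinMonoid :=
  if h : i < n then (typeB n).artinGen ⟨i, h⟩ else 1

theorem genSeq_of_lt {n i : ℕ} (h : i < n) : genSeq n i = (typeB n).artinGen ⟨i, h⟩ := dif_pos h

theorem genSeq_val {n : ℕ} (i : Fin n) : genSeq n i = (typeB n).artinGen i := genSeq_of_lt i.2

theorem artinWord_typeB {n : ℕ} (w : List (Fin n)) :
    (typeB n).artinWord w = ((w.map Fin.val).map (genSeq n)).prod := by
  rw [artinWord, List.map_map]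
  congr 1
  exact List.map_congr_left fun i _ ↦ (genSeq_val i).symm

theorem artinWord_palindromeWord {n : ℕ} (k : Fin n) :
    (typeB n).artinWord (palindromeWord k) = palindrome (genSeq n) k := by
  rw [artinWord_typeB, map_val_palindromeWord, prod_map_range_palindrome]

theorem artinWord_garsideWordB (n : ℕ) :
    (typeB n).artinWord (garsideWordB n) = palindromeProd (genSeq n) n := by
  rw [artinWord_typeB, map_val_garsideWordB, prod_map_range_palindromeProd]

theorem artinMap_artinWord {S T : Type*} (M : CoxeterMatrix S) (N : CoxeterMatrix T) (f : S → T)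
    (hf : ∀ s t, N (f s) (f t) = M s t) (w : List S) :
    artinMap M N f hf (M.artinWord w) = N.artinWord (w.map f) := by
  rw [artinWord, map_list_prod, List.map_map, artinWord, List.map_map]
  rfl

/-- The inclusion keeps vertex numbers, so the Garside word of B_n is the same product of
palindromes read in the larger monoid. -/
theorem artinMap_garsideWordB (n : ℕ) :
    artinMap (typeB n) (typeB (n + 1)) Fin.castSucc (typeB_castSucc n)
      ((typeB n).artinWord (garsideWordB n)) = palindromeProd (genSeq (n + 1)) n := by
  rw [artinMap_artinWord, artinWord_typeB, List.map_map (f := Fin.castSucc),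
    show Fin.val ∘ Fin.castSucc = (Fin.val : Fin n → ℕ) from rfl, map_val_garsideWordB,
    prod_map_range_palindromeProd]

theorem typeBSequence_genSeq (n : ℕ) : TypeBSequence n (genSeq n) := by
  have key {i j m : ℕ} (hi : i < n) (hj : j < n) (hm : typeB n ⟨i, hi⟩ ⟨j, hj⟩ = m) :
      LocalLcm (fun _ ↦ True) m (genSeq n i) (genSeq n j) := by
    rw [genSeq_of_lt hi, genSeq_of_lt hj, ← hm]
    exact localLcm typeB_le_four (cubeCondition_typeB n) _ _
  refine ⟨fun i hi ↦ key hi hi ?_, fun i j hij hj ↦ key (by omega) hj ?_,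
    fun i hi ↦ key (by omega) hi ?_, fun h ↦ key (by omega) h ?_⟩
  · exact (typeB n).diagonal _
  · rw [typeB_apply, if_neg (by simp; omega), if_neg (by simp; omega)]
  · simp [typeB_apply]
  · simp [typeB_apply]

theorem isGarside_garsideWordB (n : ℕ) :
    (typeB n).IsGarside ((typeB n).artinWord (garsideWordB n)) := by
  have hx := typeBSequence_genSeq n
  rw [artinWord_garsideWordB]
  refine ⟨fun s ↦ ?_, fun a ha ↦ hx.palindromeProd_dvd le_rfl fun i hi ↦ ?_⟩
  · rw [← genSeq_val]
    exact hx.dvd_palindromeProd s.2 le_rfl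
  · rw [genSeq_of_lt hi]
    exact ha _

theorem IsGarside.unique {S : Type*} {M : CoxeterMatrix S} {a b : M.ArtinMonoid}
    (ha : M.IsGarside a) (hb : M.IsGarside b) : a = b :=
  M.dvd_antisymm (ha.2 _ hb.1) (hb.2 _ ha.1)

theorem isGarside_typeB_iff {n : ℕ} {a : (typeB n).ArtinMonoid} :
    (typeB n).IsGarside a ↔ a = (typeB n).artinWord (garsideWordB n) :=
  ⟨fun h ↦ h.unique (isGarside_garsideWordB n), fun h ↦ h ▸ isGarside_garsideWordB n⟩

/-- The local lcm with label 1 is cancellation of one generator; it is iterated along a word for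
`a`. -/
theorem mul_left_cancel_typeB {n : ℕ} {a b c : (typeB n).ArtinMonoid} (h : a * b = a * c) :
    b = c := by
  obtain ⟨w, rfl⟩ := (typeB n).exists_artinWord a
  induction w with
  | nil => simpa [artinWord] using h
  | cons s w ih =>
    rw [artinWord_cons, mul_assoc, mul_assoc, ← genSeq_val] at h
    exact ih ((((typeBSequence_genSeq n).one s s.2).cancel _ _ trivial h).2)

end TypeBWords

end CoxeterMatrix

theorem corollary2 (n : ℕ) :
    (∀ Δ : (CoxeterMatrix.typeB (n + 1)).ArtinMonoid,
      (CoxeterMatrix.typeB (n + 1)).IsGarside Δ ↔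
        Δ = (CoxeterMatrix.typeB (n + 1)).artinWord (CoxeterMatrix.garsideWordB (n + 1))) ∧
    (∀ R : (CoxeterMatrix.typeB (n + 1)).ArtinMonoid,
      CoxeterMatrix.IsRelativeGarside (CoxeterMatrix.typeB n) (CoxeterMatrix.typeB (n + 1))
          Fin.castSucc (CoxeterMatrix.typeB_castSucc n) R ↔
        R = (CoxeterMatrix.typeB (n + 1)).artinWord
          (CoxeterMatrix.palindromeWord (Fin.last n))) ∧
    (∀ i : Fin n,
      Commute ((CoxeterMatrix.typeB (n + 1)).artinGen i.castSucc)
        ((CoxeterMatrix.typeB (n + 1)).artinWord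
          (CoxeterMatrix.palindromeWord (Fin.last n)))) := by
  refine ⟨fun Δ ↦ CoxeterMatrix.isGarside_typeB_iff, fun R ↦ ?_, fun i ↦ ?_⟩
  · rw [CoxeterMatrix.artinWord_palindromeWord]
    constructor
    · rintro ⟨Δ', Δ, h', h, e⟩
      rw [CoxeterMatrix.isGarside_typeB_iff] at h' h
      rw [h', h, CoxeterMatrix.artinMap_garsideWordB, CoxeterMatrix.artinWord_garsideWordB] at e
      exact (CoxeterMatrix.mul_left_cancel_typeB e).symm
    · rintro rfl
      refine ⟨_, _, CoxeterMatrix.isGarside_garsideWordB n,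
        CoxeterMatrix.isGarside_garsideWordB (n + 1), ?_⟩
      rw [CoxeterMatrix.artinMap_garsideWordB, CoxeterMatrix.artinWord_garsideWordB]
      -- This is Q_{n+1} = Q_n P_n, by definition.
      rfl
  · rw [CoxeterMatrix.artinWord_palindromeWord, ← CoxeterMatrix.genSeq_val]
    exact (CoxeterMatrix.typeBSequence_genSeq (n + 1)).commute_palindrome i.2 (Nat.lt_succ_self n)
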